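/- Let $K$ be an algebraically closed field, $R=K[x_0,x_1,x_2]$ the homogeneous coordinate ring of $\mathbb{P}^2$, and $M=(x_0,x_1,x_2)$. Let $L_1,\dots,L_s\subset\mathbb{P}^2$, $s\ge 2$, be distinct lines, no three of which meet at a point, and let $I\subseteq R$ be the radical ideal of the star configuration they define, i.e. the ideal generated by all forms vanishing at each of the $\binom{s}{2}$ points of pairwise intersection $L_i\cap L_j$, $i\neq j$. For $m\ge 0$ let $I^{(m)}=\bigcap_{P\in\operatorname{Ass}(R/I)}(I^mR_P\cap R)$ be the $m$-th symbolic power of $I$. Then: (1) $I^{(2j+1)}=(I^{(2)})^j\,I$ for all $j\ge 0$. (2) If moreover $\operatorname{char}(K)=0$, then for all $m,t\ge 1$ $$I^{(t(m+1))}\subseteq M^t(I^{(m)})^t,\qquad I^{(t(m+1)-1)}\subseteq (I^{(m)})^t,\qquad I^{(t(m+1)-1)}\subseteq M^{t-1}(I^{(m)})^t .$$ -/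

import Mathlib

open scoped LinearAlgebra.Projectivization

noncomputable section

namespace StarConfig

/-- The `m`-th symbolic power of an ideal `I` of a (Noetherian) commutative ring `R`:
`⋂_{P ∈ Ass(R/I)} (I ^ m R_P ∩ R)`, that is, the intersection of those primary components of
`I ^ m` whose radical is contained in an associated prime of `I`. -/
def symbolicPower {R : Type*} [CommRing R] (I : Ideal R) (m : ℕ) : Ideal R :=
  ⨅ (P : Ideal R) (_ : P.IsPrime) (_ : P ∈ associatedPrimes R (R ⧸ I)),
    ((I ^ m).map (algebraMap R (Localization.AtPrime P))).comap
      (algebraMap R (Localization.AtPrime P))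

/-- The irrelevant ideal `M = (x_0, x_1, x_2)` of the homogeneous coordinate ring of the
projective plane. -/
def irrelevantIdeal (K : Type*) [Field K] : Ideal (MvPolynomial (Fin 3) K) :=
  Ideal.span (Set.range MvPolynomial.X)

/-- The homogeneous ideal of a set `Z` of points of the projective plane: the ideal generated by
the forms that vanish at every point of `Z`. (For a form, vanishing at a point does not depend on
the representative of the point.) It is a radical ideal. -/
def pointsIdeal {K : Type*} [Field K] (Z : Set (ℙ K (Fin 3 → K))) :
    Ideal (MvPolynomial (Fin 3) K) :=
  Ideal.span {F | (∃ d : ℕ, F.IsHomogeneous d) ∧ ∀ p ∈ Z, MvPolynomial.eval p.rep F = 0}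

/-- The line `a_0 x_0 + a_1 x_1 + a_2 x_2 = 0` of the projective plane, where
`a = [a_0 : a_1 : a_2]` is a point of the dual plane. Distinct `a` give distinct lines. -/
def line {K : Type*} [Field K] (a : ℙ K (Fin 3 → K)) : Set (ℙ K (Fin 3 → K)) :=
  {p | Projectivization.orthogonal a p}

/-- A family of `s ≥ 2` distinct lines of the projective plane, no three of which meet
at a point. -/
structure IsStarArrangement {K : Type*} [Field K] {s : ℕ} (a : Fin s → ℙ K (Fin 3 → K)) :
    Prop where
  two_le : 2 ≤ s
  injective : Function.Injective a
  no_three : ∀ i j k : Fin s, i ≠ j → i ≠ k → j ≠ k →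
    line (a i) ∩ line (a j) ∩ line (a k) = ∅

/-- The points at which two of the lines meet. -/
def starPoints {K : Type*} [Field K] {s : ℕ} (a : Fin s → ℙ K (Fin 3 → K)) :
    Set (ℙ K (Fin 3 → K)) :=
  {p | ∃ i j : Fin s, i ≠ j ∧ p ∈ line (a i) ∧ p ∈ line (a j)}

end StarConfig

end

/-! Write `l i` for the linear form of the line `L_i`. The symbolic powers of `I` turn out to be
spanned by products of the forms `l i`: `I^(m)` is the intersection of the ideals `(l i, l j) ^ m`,
and it is generated by the products `∏ l i ^ a i` with `a i + a j ≥ m` for all `i ≠ j`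
(`symbolicPower_eq`, resting on `mem_monomialIdeal`). The hard inclusion restricts an element to one
line `L_i`, where unique factorization shows it to be a multiple of a product of the other forms;
subtracting that multiple leaves something divisible by `l i`, and induction applies to the
quotient.

Everything else is combinatorics of exponents: `I^(n+2) = I^(2) I^(n)` (`monomialIdeal_add_two`) and
`I^(n+1) ⊆ M I^(n)` (`monomialIdeal_succ_le`). Part (1) follows by iterating the former, and the
containments of (2) follow from both by splitting on the parity of `m` (`containment`). -/

namespace StarConfig

/-! ### Order of vanishing at a point and restriction to a line, in coordinates. -/

section Frame

open MvPolynomial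

variable {K : Type*} [Field K]

/-- The substitution `x₀ ↦ x₀ T`, `x₁ ↦ x₁ T`, which records the order of vanishing along
`x₀ = x₁ = 0` as a power of `T`. -/
noncomputable def orderHom (K : Type*) [Field K] :
    MvPolynomial (Fin 3) K →ₐ[K] Polynomial (MvPolynomial (Fin 3) K) :=
  aeval ![Polynomial.X * Polynomial.C (X 0), Polynomial.X * Polynomial.C (X 1),
    Polynomial.C (X 2)]

/-- The substitution `x₀ ↦ 0`. -/
noncomputable def restrictHom (K : Type*) [Field K] :
    MvPolynomial (Fin 3) K →ₐ[K] MvPolynomial (Fin 3) K :=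
  aeval ![0, X 1, X 2]

theorem orderHom_mem_reesAlgebra (F : MvPolynomial (Fin 3) K) :
    orderHom K F ∈ reesAlgebra (Ideal.span {X 0, X 1} : Ideal (MvPolynomial (Fin 3) K)) := by
  induction F using MvPolynomial.induction_on with
  | C c =>
    rw [← algebraMap_eq, AlgHom.commutes]
    rw [IsScalarTower.algebraMap_apply K (MvPolynomial (Fin 3) K)]
    exact Subalgebra.algebraMap_mem _ _
  | add p q hp hq => rw [map_add]; exact Subalgebra.add_mem _ hp hq
  | mul_X p i hp =>
    rw [map_mul]
    refine Subalgebra.mul_mem _ hp ?_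
    fin_cases i
    · simp only [orderHom, aeval_X, Fin.zero_eta, Matrix.cons_val_zero]
      rw [mul_comm, Polynomial.C_mul_X_eq_monomial]
      exact reesAlgebra.monomial_mem.2 (by simpa using Ideal.subset_span (by simp))
    · simp only [orderHom, aeval_X, Fin.mk_one, Matrix.cons_val_one]
      rw [mul_comm, Polynomial.C_mul_X_eq_monomial]
      exact reesAlgebra.monomial_mem.2 (by simpa using Ideal.subset_span (by simp))
    · simp only [orderHom, aeval_X]
      exact Subalgebra.algebraMap_mem _ (X 2 : MvPolynomial (Fin 3) K)

theorem eval_one_orderHom (F : MvPolynomial (Fin 3) K) :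
    Polynomial.eval 1 (orderHom K F) = F := by
  have h : ((Polynomial.aeval (R := MvPolynomial (Fin 3) K) 1).restrictScalars K).comp
      (orderHom K) = AlgHom.id K (MvPolynomial (Fin 3) K) := by
    ext i : 1
    fin_cases i <;> simp [orderHom]
  simpa [Polynomial.aeval_def] using DFunLike.congr_fun h F

/-- The coefficient of `T ^ n` in the image of `F` lies in `(x₀, x₁) ^ n`, and setting `T = 1`
recovers `F`. Since `T` is prime, the criterion makes the powers of `(x₀, x₁)` primary. -/
theorem mem_span_pow_iff_X_pow_dvd (F : MvPolynomial (Fin 3) K) (r : ℕ) :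
    F ∈ (Ideal.span {X 0, X 1} : Ideal (MvPolynomial (Fin 3) K)) ^ r ↔
      Polynomial.X ^ r ∣ orderHom K F := by
  constructor
  · intro h
    have hle : Ideal.map (orderHom K) (Ideal.span {X 0, X 1}) ≤ Ideal.span {Polynomial.X} := by
      rw [Ideal.map_span, Ideal.span_le]
      rintro _ ⟨p, rfl | rfl, rfl⟩ <;>
        simp [orderHom, Ideal.mem_span_singleton]
    rw [← Ideal.mem_span_singleton, ← Ideal.span_singleton_pow]
    refine Ideal.pow_right_mono hle r ?_
    rw [← Ideal.map_pow]
    exact Ideal.mem_map_of_mem _ h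
  · intro h
    rw [Polynomial.X_pow_dvd_iff] at h
    rw [← eval_one_orderHom F, Polynomial.eval_eq_sum_range]
    refine Ideal.sum_mem _ fun n _ => ?_
    rw [one_pow, mul_one]
    by_cases hn : n < r
    · rw [h n hn]; exact zero_mem _
    · exact Ideal.pow_le_pow_right (not_lt.1 hn)
        ((mem_reesAlgebra_iff _ _).1 (orderHom_mem_reesAlgebra F) n)

/-- `F` is congruent to its restriction modulo `x₀`, so membership is decided on the line `x₀ = 0`,
where `x₁` is prime. -/
theorem mem_span_X_pow_iff_dvd (F : MvPolynomial (Fin 3) K) (r : ℕ) :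
    F ∈ (Ideal.span {X 0, X 1 ^ r} : Ideal (MvPolynomial (Fin 3) K)) ↔
      X 1 ^ r ∣ restrictHom K F := by
  have hsub : ∀ G : MvPolynomial (Fin 3) K, G - restrictHom K G ∈ Ideal.span {X 0} := by
    intro G
    induction G using MvPolynomial.induction_on with
    | C c => simp [restrictHom]
    | add p q hp hq =>
      rw [map_add, add_sub_add_comm]; exact add_mem hp hq
    | mul_X p i hp =>
      have hX : X i - restrictHom K (X i) ∈
          (Ideal.span {X 0} : Ideal (MvPolynomial (Fin 3) K)) := by
        fin_cases i <;> simp [restrictHom]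
      have : p * X i - restrictHom K (p * X i) =
          X i * (p - restrictHom K p) + restrictHom K p * (X i - restrictHom K (X i)) := by
        rw [map_mul]; ring
      rw [this]
      exact add_mem (Ideal.mul_mem_left _ _ hp) (Ideal.mul_mem_left _ _ hX)
  constructor
  · intro h
    rw [← Ideal.mem_span_singleton]
    have hle : Ideal.map (restrictHom K) (Ideal.span {X 0, X 1 ^ r}) ≤
        Ideal.span {X 1 ^ r} := by
      rw [Ideal.map_span, Ideal.span_le]
      rintro _ ⟨p, rfl | rfl, rfl⟩ <;> simp [restrictHom]
    exact hle (Ideal.mem_map_of_mem _ h)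
  · intro h
    rw [← sub_add_cancel F (restrictHom K F)]
    refine add_mem (Ideal.span_mono (by simp) (hsub F)) ?_
    exact Ideal.span_mono (by simp) (Ideal.mem_span_singleton.2 h)

/-- Three polynomials that are the images of the coordinates under an automorphism of the
polynomial ring. -/
def IsFrame (x y z : MvPolynomial (Fin 3) K) : Prop :=
  ∃ φ : MvPolynomial (Fin 3) K ≃ₐ[K] MvPolynomial (Fin 3) K,
    φ (X 0) = x ∧ φ (X 1) = y ∧ φ (X 2) = z

namespace IsFrame

variable {x y z : MvPolynomial (Fin 3) K}

theorem exists_order (h : IsFrame x y z) :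
    ∃ ψ : MvPolynomial (Fin 3) K →ₐ[K] Polynomial (MvPolynomial (Fin 3) K),
      (∀ F r, F ∈ Ideal.span {x, y} ^ r ↔ Polynomial.X ^ r ∣ ψ F) ∧
      ψ x = Polynomial.X * Polynomial.C (X 0) ∧ ψ z = Polynomial.C (X 2) := by
  obtain ⟨φ, rfl, rfl, rfl⟩ := h
  refine ⟨(orderHom K).comp φ.symm, fun F r => ?_, by simp [orderHom], by simp [orderHom]⟩
  have : Ideal.span {φ (X 0), φ (X 1)} ^ r =
      Ideal.map φ ((Ideal.span {X 0, X 1} : Ideal (MvPolynomial (Fin 3) K)) ^ r) := by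
    rw [Ideal.map_pow, Ideal.map_span, Set.image_pair]
  rw [this, AlgHom.comp_apply, ← mem_span_pow_iff_X_pow_dvd]
  have := Ideal.mem_map_of_equiv φ.toRingEquiv
    (I := (Ideal.span {X 0, X 1} : Ideal (MvPolynomial (Fin 3) K)) ^ r) F
  refine this.trans ⟨?_, fun h => ⟨_, h, by simp⟩⟩
  rintro ⟨G, hG, rfl⟩
  simpa using hG

theorem mem_pow_of_mul_mem (h : IsFrame x y z) {u F : MvPolynomial (Fin 3) K} {r : ℕ}
    (hu : u ∉ Ideal.span {x, y}) (hF : u * F ∈ Ideal.span {x, y} ^ r) :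
    F ∈ Ideal.span {x, y} ^ r := by
  obtain ⟨ψ, hψ, -, -⟩ := h.exists_order
  rw [← pow_one (Ideal.span {x, y}), hψ, pow_one] at hu
  rw [hψ, map_mul] at hF
  rw [hψ]
  exact Polynomial.prime_X.pow_dvd_of_dvd_mul_left r hu hF

theorem mem_pow_of_left_mul_mem (h : IsFrame x y z) {F : MvPolynomial (Fin 3) K} {r : ℕ}
    (hF : x * F ∈ Ideal.span {x, y} ^ (r + 1)) : F ∈ Ideal.span {x, y} ^ r := by
  obtain ⟨ψ, hψ, hx, -⟩ := h.exists_order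
  rw [hψ, map_mul, hx, pow_succ', mul_assoc,
    mul_dvd_mul_iff_left Polynomial.X_ne_zero] at hF
  rw [hψ]
  refine Polynomial.prime_X.pow_dvd_of_dvd_mul_left r ?_ hF
  simp [Polynomial.X_dvd_iff]

theorem notMem (h : IsFrame x y z) : z ∉ Ideal.span {x, y} := by
  obtain ⟨ψ, hψ, -, hz⟩ := h.exists_order
  rw [← pow_one (Ideal.span {x, y}), hψ, hz, pow_one]
  simp [Polynomial.X_dvd_iff]

theorem isPrime (h : IsFrame x y z) : (Ideal.span {x, y}).IsPrime := by
  refine ⟨fun ht => h.notMem (ht ▸ Submodule.mem_top), fun {u v} huv => ?_⟩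
  by_contra! hc
  have := h.mem_pow_of_mul_mem (r := 1) hc.1 (by simpa using huv)
  exact hc.2 (by simpa using this)

theorem mem_span_pow_of_mul_mem (h : IsFrame x y z) {u F : MvPolynomial (Fin 3) K} {r : ℕ}
    (hu : u ∉ Ideal.span {x, y}) (hF : u * F ∈ Ideal.span {x, y ^ r}) :
    F ∈ Ideal.span {x, y ^ r} := by
  obtain ⟨φ, rfl, rfl, rfl⟩ := h
  have key : ∀ (G : MvPolynomial (Fin 3) K) (n : ℕ), G ∈ Ideal.span {φ (X 0), φ (X 1) ^ n} ↔
      X 1 ^ n ∣ restrictHom K (φ.symm G) := by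
    intro G n
    have : Ideal.span {φ (X 0), φ (X 1) ^ n} =
        Ideal.map φ (Ideal.span {X 0, X 1 ^ n} : Ideal (MvPolynomial (Fin 3) K)) := by
      rw [Ideal.map_span, Set.image_pair, map_pow]
    rw [this, ← mem_span_X_pow_iff_dvd]
    have := Ideal.mem_map_of_equiv φ.toRingEquiv
      (I := (Ideal.span {X 0, X 1 ^ n} : Ideal (MvPolynomial (Fin 3) K))) G
    refine this.trans ⟨?_, fun h => ⟨_, h, by simp⟩⟩
    rintro ⟨G, hG, rfl⟩
    simpa using hG
  rw [← pow_one (φ (X 1)), key, pow_one] at hu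
  rw [key, map_mul, map_mul] at hF
  rw [key]
  exact (X_prime (i := (1 : Fin 3))).pow_dvd_of_dvd_mul_left r hu hF

end IsFrame

theorem span_pair_pow_le {R : Type*} [CommRing R] (x y : R) (r : ℕ) :
    Ideal.span {x, y} ^ r ≤ Ideal.span {x, y ^ r} := by
  induction r with
  | zero => simp [Ideal.span_insert]
  | succ r ih =>
    rw [pow_succ]
    refine (Ideal.mul_mono_left ih).trans ?_
    rw [Ideal.span_pair_mul_span_pair, Ideal.span_le]
    have hx : ∀ c, c * x ∈ Ideal.span {x, y ^ (r + 1)} := fun c =>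
      Ideal.mul_mem_left _ _ (Ideal.subset_span (by simp))
    rintro _ (rfl | rfl | rfl | rfl)
    · exact hx x
    · rw [mul_comm]; exact hx y
    · exact hx _
    · exact Ideal.subset_span (by simp [pow_succ])

end Frame

/-! ### Intersections of powers of the primes `(l i, l j)` are generated by products of the forms.
-/

section Monomial

variable {R ι : Type*} [CommRing R] [Fintype ι] [DecidableEq ι]

/-- The ideal-theoretic properties of the linear forms of a star configuration: two of them
generate a prime ideal with primary powers, which contains none of the other forms. -/
structure IsStarFamily (l : ι → R) : Prop where
  notMem : ∀ {i j k}, i ≠ j → i ≠ k → j ≠ k → l k ∉ Ideal.span {l i, l j}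
  isPrime : ∀ {i j}, i ≠ j → (Ideal.span {l i, l j}).IsPrime
  mem_pow_of_mul_mem : ∀ {i j}, i ≠ j → ∀ {u F : R} {r : ℕ}, u ∉ Ideal.span {l i, l j} →
    u * F ∈ Ideal.span {l i, l j} ^ r → F ∈ Ideal.span {l i, l j} ^ r
  mem_pow_of_left_mul_mem : ∀ {i j}, i ≠ j → ∀ {F : R} {r : ℕ},
    l i * F ∈ Ideal.span {l i, l j} ^ (r + 1) → F ∈ Ideal.span {l i, l j} ^ r
  mem_span_pow_of_mul_mem : ∀ {i j}, i ≠ j → ∀ {u F : R} {r : ℕ}, u ∉ Ideal.span {l i, l j} →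
    u * F ∈ Ideal.span {l i, l j ^ r} → F ∈ Ideal.span {l i, l j ^ r}

/-- The ideal generated by the products of powers of the `l i` in which any two exponents `a i`,
`a j` satisfy `m ≤ a i + a j + c i + c j`. -/
def monomialIdeal (l : ι → R) (m : ℕ) (c : ι → ℕ) : Ideal R :=
  Ideal.span {F | ∃ a : ι → ℕ, (∀ i j, i ≠ j → m ≤ a i + a j + c i + c j) ∧
    ∏ i, l i ^ a i = F}

omit [DecidableEq ι] in
theorem prod_mem_monomialIdeal (l : ι → R) {m : ℕ} {c a : ι → ℕ}
    (h : ∀ i j, i ≠ j → m ≤ a i + a j + c i + c j) :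
    ∏ i, l i ^ a i ∈ monomialIdeal l m c :=
  Ideal.subset_span ⟨a, h, rfl⟩

theorem prod_mem_pow (l : ι → R) {m : ℕ} {a : ι → ℕ} {i j : ι} (hij : i ≠ j)
    (h : m ≤ a i + a j) : ∏ k, l k ^ a k ∈ Ideal.span {l i, l j} ^ m := by
  rw [← Finset.mul_prod_erase _ _ (Finset.mem_univ i),
    ← Finset.mul_prod_erase _ _ (Finset.mem_erase.2 ⟨hij.symm, Finset.mem_univ j⟩), ← mul_assoc]
  refine Ideal.mul_mem_right _ _ (Ideal.pow_le_pow_right h ?_)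
  rw [pow_add]
  exact Ideal.mul_mem_mul (Ideal.pow_mem_pow (Ideal.subset_span (by simp)) _)
    (Ideal.pow_mem_pow (Ideal.subset_span (by simp)) _)

theorem monomialIdeal_le_pow (l : ι → R) (m : ℕ) {i j : ι} (hij : i ≠ j) :
    monomialIdeal l m 0 ≤ Ideal.span {l i, l j} ^ m := by
  rw [monomialIdeal, Ideal.span_le]
  rintro _ ⟨a, ha, rfl⟩
  exact prod_mem_pow l hij (by simpa using ha i j hij)

theorem mul_prod_pow (l : ι → R) (a : ι → ℕ) (i : ι) :
    l i * ∏ j, l j ^ a j = ∏ j, l j ^ (a j + if j = i then 1 else 0) := by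
  simp only [pow_add, Finset.prod_mul_distrib]
  simp [mul_comm]

/-- Multiplying by `l i` raises the exponent of `l i`. -/
theorem mul_mem_monomialIdeal (l : ι → R) {m : ℕ} {c : ι → ℕ} (i : ι) {H : R}
    (hH : H ∈ monomialIdeal l m (c + Pi.single i 1)) : l i * H ∈ monomialIdeal l m c := by
  have hle : Ideal.span {l i} * monomialIdeal l m (c + Pi.single i 1) ≤ monomialIdeal l m c := by
    rw [monomialIdeal, Ideal.span_mul_span', Ideal.span_le]
    rintro _ ⟨_, rfl, _, ⟨a, ha, rfl⟩, rfl⟩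
    simp only [mul_prod_pow]
    refine prod_mem_monomialIdeal l fun j k hjk => ?_
    have := ha j k hjk
    simp only [Pi.add_apply, Pi.single_apply] at this
    omega
  exact hle (Ideal.mul_mem_mul (Ideal.mem_span_singleton_self _) hH)

namespace IsStarFamily

variable {l : ι → R} (hl : IsStarFamily l)
include hl

-- This is unique factorization on the line `l i = 0`: the restrictions of the other `l j` are
-- pairwise coprime there because no three lines meet, so the separate divisibilities by `l j ^ e j`
-- combine into divisibility by the product.
omit [Fintype ι] in
theorem mem_span_prod {i : ι} (T : Finset ι) (hT : i ∉ T) (e : ι → ℕ) {F : R}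
    (hF : ∀ j ∈ T, F ∈ Ideal.span {l i, l j} ^ e j) :
    F ∈ Ideal.span {l i, ∏ j ∈ T, l j ^ e j} := by
  induction T using Finset.induction_on with
  | empty => simp [Ideal.span_insert]
  | insert k T hk ih =>
    have hik : i ≠ k := fun h => hT (h ▸ Finset.mem_insert_self _ _)
    have hiT : i ∉ T := fun h => hT (Finset.mem_insert_of_mem h)
    obtain ⟨A, G, hAG⟩ := Ideal.mem_span_pair.1
      (ih hiT fun j hj => hF j (Finset.mem_insert_of_mem hj))
    have hFk := span_pair_pow_le _ _ _ (hF k (Finset.mem_insert_self _ _))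
    have hprod : ∏ j ∈ T, l j ^ e j ∉ Ideal.span {l i, l k} := by
      have := hl.isPrime hik
      rw [Ideal.IsPrime.prod_mem_iff]
      rintro ⟨j, hj, hj'⟩
      exact hl.notMem hik (fun h => hiT (h ▸ hj)) (fun h => hk (h ▸ hj))
        (this.mem_of_pow_mem _ hj')
    have hG : G ∈ Ideal.span {l i, l k ^ e k} := by
      refine hl.mem_span_pow_of_mul_mem hik hprod ?_
      have : (∏ j ∈ T, l j ^ e j) * G = F - A * l i := by rw [← hAG]; ring
      rw [this]
      exact sub_mem hFk (Ideal.mul_mem_left _ _ (Ideal.subset_span (by simp)))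
    obtain ⟨B, C, hBC⟩ := Ideal.mem_span_pair.1 hG
    rw [Finset.prod_insert hk]
    refine Ideal.mem_span_pair.2 ⟨A + B * ∏ j ∈ T, l j ^ e j, C, ?_⟩
    rw [← hAG, ← hBC]
    ring

/-- The shift `c` counts the factors `l i` already divided out; it is what lets the induction pass
from `F` to the quotient `H`. The subtractions are truncated, so a pair with `m ≤ c i + c j` imposes
no condition. -/
theorem mem_monomialIdeal (m : ℕ) (c : ι → ℕ) {F : R}
    (hF : ∀ i j, i ≠ j → F ∈ Ideal.span {l i, l j} ^ (m - c i - c j)) :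
    F ∈ monomialIdeal l m c := by
  induction hN : ∑ i, (m + 1 - 2 * c i) using Nat.strong_induction_on generalizing c F with
  | _ N ih =>
  by_cases hc : ∃ i, 2 * c i ≤ m
  · obtain ⟨i, hi⟩ := hc
    obtain ⟨H, G, hHG⟩ := Ideal.mem_span_pair.1 <| hl.mem_span_prod (i := i) (Finset.univ.erase i)
      (Finset.notMem_erase _ _) (fun j => m - c i - c j)
      (fun j hj => hF i j (Finset.ne_of_mem_erase hj).symm)
    have hprod : ∏ j ∈ Finset.univ.erase i, l j ^ (m - c i - c j) =
        ∏ j, l j ^ (if j = i then 0 else m - c i - c j) := by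
      rw [← Finset.mul_prod_erase _ (fun j => l j ^ (if j = i then 0 else m - c i - c j))
        (Finset.mem_univ i), if_pos rfl, pow_zero, one_mul]
      exact Finset.prod_congr rfl fun j hj => by rw [if_neg (Finset.ne_of_mem_erase hj)]
    -- The exponents vanish at `i` and are `m - c i - c j` elsewhere. For two indices other than `i`
    -- the total is at least `2 * (m - c i)`, which is at least `m` because `2 * c i ≤ m`.
    have hmon : ∀ j k, j ≠ k → m ≤ (if j = i then 0 else m - c i - c j) +
        (if k = i then 0 else m - c i - c k) + c j + c k := by
      intro j k hjk
      split_ifs with h1 h2 h2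
      · exact absurd (h1.trans h2.symm) hjk
      · subst h1; omega
      · subst h2; omega
      · omega
    rw [hprod] at hHG
    have hmem := prod_mem_monomialIdeal l (c := c) hmon
    have hlH : l i * H = F - G * ∏ j, l j ^ (if j = i then 0 else m - c i - c j) := by
      rw [← hHG]; ring
    have hlHmem : ∀ j k, j ≠ k → l i * H ∈ Ideal.span {l j, l k} ^ (m - c j - c k) := by
      intro j k hjk
      rw [hlH]
      refine sub_mem (hF j k hjk) (Ideal.mul_mem_left _ _ (prod_mem_pow l hjk ?_))
      have := hmon j k hjk
      omega
    rw [← hHG]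
    refine add_mem ?_ (Ideal.mul_mem_left _ _ hmem)
    rw [mul_comm]
    refine mul_mem_monomialIdeal l i (ih _ ?_ _ ?_ rfl)
    · rw [← hN]
      refine Finset.sum_lt_sum (fun j _ => ?_) ⟨i, Finset.mem_univ i, ?_⟩
      · simp only [Pi.add_apply]; omega
      · simp only [Pi.add_apply, Pi.single_eq_same]; omega
    · have hleft : ∀ k, i ≠ k → H ∈ Ideal.span {l i, l k} ^ (m - (c i + 1) - c k) := by
        intro k hik
        rcases Nat.eq_zero_or_pos (m - c i - c k) with h0 | h0
        · rw [show m - (c i + 1) - c k = 0 by omega, pow_zero, Ideal.one_eq_top]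
          trivial
        · exact hl.mem_pow_of_left_mul_mem hik
            (Ideal.pow_le_pow_right (by omega) (hlHmem i k hik))
      intro j k hjk
      simp only [Pi.add_apply]
      by_cases hj : j = i
      · subst hj
        simpa [Pi.single_eq_of_ne hjk.symm] using hleft k hjk
      by_cases hk : k = i
      · subst hk
        rw [Set.pair_comm]
        simpa [Pi.single_eq_of_ne hj, Nat.sub_right_comm] using hleft j (Ne.symm hj)
      rw [Pi.single_eq_of_ne hj, Pi.single_eq_of_ne hk]
      exact hl.mem_pow_of_mul_mem hjk (hl.notMem hjk hj hk) (hlHmem j k hjk)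
  · push Not at hc
    -- Now every `2 * c i` exceeds `m`, so zero exponents are admissible and the ideal contains `1`.
    have := prod_mem_monomialIdeal l (m := m) (c := c) (a := 0) fun i j _ => by
      have := hc i; have := hc j; simp; omega
    simp only [Pi.zero_apply, pow_zero, Finset.prod_const_one] at this
    rw [(Ideal.eq_top_iff_one _).2 this]
    trivial

end IsStarFamily

end Monomial

/-! ### Arithmetic of the monomial ideals, associated primes and symbolic powers. -/

section Symbolic

variable {R ι : Type*} [CommRing R] [Fintype ι] [DecidableEq ι]

omit [DecidableEq ι] in
theorem monomialIdeal_zero (l : ι → R) : monomialIdeal l 0 0 = ⊤ := by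
  rw [Ideal.eq_top_iff_one]
  simpa using prod_mem_monomialIdeal l (m := 0) (c := 0) (a := 0) (by simp)

/-- If all exponents are positive, split off one copy of each form. If `a i = 0`, every other
exponent is at least `n + 2`, so split off the squares of the other forms. -/
theorem monomialIdeal_add_two (l : ι → R) (n : ℕ) :
    monomialIdeal l (n + 2) 0 = monomialIdeal l 2 0 * monomialIdeal l n 0 := by
  apply le_antisymm
  · rw [monomialIdeal, Ideal.span_le]
    rintro _ ⟨a, ha, rfl⟩
    simp only [Pi.zero_apply, add_zero] at ha
    have key : ∀ b : ι → ℕ, (∀ i, b i ≤ a i) → (∀ i j, i ≠ j → 2 ≤ b i + b j) →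
        (∀ i j, i ≠ j → n ≤ (a i - b i) + (a j - b j)) →
        ∏ i, l i ^ a i ∈ monomialIdeal l 2 0 * monomialIdeal l n 0 := by
      intro b hb h2 hn
      have : ∏ i, l i ^ a i = (∏ i, l i ^ b i) * ∏ i, l i ^ (a i - b i) := by
        rw [← Finset.prod_mul_distrib]
        exact Finset.prod_congr rfl fun i _ => by rw [← pow_add, Nat.add_sub_cancel' (hb i)]
      rw [this]
      exact Ideal.mul_mem_mul (prod_mem_monomialIdeal l (by simpa using h2))
        (prod_mem_monomialIdeal l (by simpa using hn))
    by_cases h0 : ∃ i, a i = 0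
    · obtain ⟨i, hi⟩ := h0
      have hbig : ∀ j, j ≠ i → n + 2 ≤ a j := fun j hj => by
        have := ha j i hj
        omega
      refine key (fun j => if j = i then 0 else 2) (fun j => ?_) (fun j k hjk => ?_)
        (fun j k hjk => ?_)
      · split_ifs with h
        · exact Nat.zero_le _
        · have := hbig j h; omega
      · by_cases hj : j = i
        · have hk : k ≠ i := fun h => hjk (hj.trans h.symm)
          simp [hj, hk]
        · simp [hj]
      · by_cases hj : j = i
        · have hk : k ≠ i := fun h => hjk (hj.trans h.symm)
          have := hbig k hk
          simp only [if_neg hk]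
          omega
        · have := hbig j hj
          simp only [if_neg hj]
          omega
    · push Not at h0
      have h1 : ∀ i, 1 ≤ a i := fun i => Nat.one_le_iff_ne_zero.2 (h0 i)
      refine key (fun _ => 1) h1 (fun _ _ _ => le_rfl) fun i j hij => ?_
      have := ha i j hij
      have := h1 i
      have := h1 j
      omega
  · rw [monomialIdeal, monomialIdeal, Ideal.span_mul_span', Ideal.span_le]
    rintro _ ⟨_, ⟨a, ha, rfl⟩, _, ⟨b, hb, rfl⟩, rfl⟩
    simp only [← Finset.prod_mul_distrib, ← pow_add]
    refine prod_mem_monomialIdeal l fun i j hij => ?_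
    have := ha i j hij
    have := hb i j hij
    simp only [Pi.zero_apply] at *
    omega

theorem monomialIdeal_succ_le [Nontrivial ι] (l : ι → R) {M : Ideal R} (hM : ∀ i, l i ∈ M)
    (n : ℕ) : monomialIdeal l (n + 1) 0 ≤ M * monomialIdeal l n 0 := by
  rw [monomialIdeal, Ideal.span_le]
  rintro _ ⟨a, ha, rfl⟩
  simp only [Pi.zero_apply, add_zero] at ha
  obtain ⟨i, hi⟩ : ∃ i, 1 ≤ a i := by
    obtain ⟨i, j, hij⟩ := exists_pair_ne ι
    have := ha i j hij
    by_cases h : 1 ≤ a i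
    · exact ⟨i, h⟩
    · exact ⟨j, by omega⟩
  have : ∏ j, l j ^ a j = l i * ∏ j, l j ^ (a j - if j = i then 1 else 0) := by
    rw [mul_prod_pow]
    refine Finset.prod_congr rfl fun j _ => ?_
    split_ifs with h
    · subst h; rw [Nat.sub_add_cancel hi]
    · rfl
  rw [this]
  refine Ideal.mul_mem_mul (hM i) (prod_mem_monomialIdeal l fun j k hjk => ?_)
  have := ha j k hjk
  simp only [Pi.zero_apply]
  split_ifs with h1 h2
  · exact absurd (h1.trans h2.symm) hjk
  all_goals omega

namespace IsStarFamily

variable {l : ι → R} (hl : IsStarFamily l)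
include hl

theorem mem_monomialIdeal_iff (m : ℕ) {F : R} :
    F ∈ monomialIdeal l m 0 ↔ ∀ i j, i ≠ j → F ∈ Ideal.span {l i, l j} ^ m :=
  ⟨fun h _ _ hij => monomialIdeal_le_pow l m hij h,
    fun h => hl.mem_monomialIdeal m 0 (by simpa using h)⟩

/-- Each of the primes `(l i, l j)` is the annihilator of an element modulo the ideal of the star
configuration. -/
theorem exists_colon {i j : ι} (hij : i ≠ j) :
    ∃ v, v ∉ Ideal.span {l i, l j} ∧ ∀ F, v * F ∈ monomialIdeal l 1 0 ↔
      F ∈ Ideal.span {l i, l j} := by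
  have hprime := hl.isPrime hij
  have hv : ∏ k ∈ (Finset.univ.erase i).erase j, l k ∉ Ideal.span {l i, l j} := by
    rw [Ideal.IsPrime.prod_mem_iff]
    rintro ⟨k, hk, hk'⟩
    rw [Finset.mem_erase, Finset.mem_erase] at hk
    exact hl.notMem hij hk.2.1.symm hk.1.symm hk'
  refine ⟨_, hv, fun F => ⟨fun h => ?_, fun h => ?_⟩⟩
  · have := (hl.mem_monomialIdeal_iff 1).1 h i j hij
    rw [pow_one] at this
    exact (hprime.mem_or_mem this).resolve_left hv
  · rw [hl.mem_monomialIdeal_iff]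
    intro p q hpq
    rw [pow_one]
    by_cases hp : p ∈ (Finset.univ.erase i).erase j
    · exact Ideal.mul_mem_right _ _ (Ideal.mem_of_dvd _ (Finset.dvd_prod_of_mem l hp)
        (Ideal.subset_span (by simp)))
    by_cases hq : q ∈ (Finset.univ.erase i).erase j
    · exact Ideal.mul_mem_right _ _ (Ideal.mem_of_dvd _ (Finset.dvd_prod_of_mem l hq)
        (Ideal.subset_span (by simp)))
    refine Ideal.mul_mem_left _ _ ?_
    simp only [Finset.mem_erase, Finset.mem_univ, and_true, not_and_or, not_not] at hp hq
    rcases hp with rfl | rfl <;> rcases hq with rfl | rfl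
    · exact absurd rfl hpq
    · rwa [Set.pair_comm]
    · exact h
    · exact absurd rfl hpq

theorem mem_associatedPrimes_iff [IsNoetherianRing R] (P : Ideal R) :
    P ∈ associatedPrimes R (R ⧸ monomialIdeal l 1 0) ↔
      ∃ i j, i ≠ j ∧ P = Ideal.span {l i, l j} := by
  have hmem : ∀ x r : R, r ∈ (⊥ : Submodule R (R ⧸ monomialIdeal l 1 0)).colon
      {Ideal.Quotient.mk _ x} ↔ x * r ∈ monomialIdeal l 1 0 := by
    intro x r
    rw [Submodule.mem_colon_singleton, Submodule.mem_bot, ← Ideal.Quotient.mk_eq_mk,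
      ← Submodule.Quotient.mk_smul, Submodule.Quotient.mk_eq_zero, smul_eq_mul, mul_comm]
  change IsAssociatedPrime _ _ ↔ _
  rw [isAssociatedPrime_iff]
  constructor
  · rintro ⟨hP, x, hx⟩
    obtain ⟨x, rfl⟩ := Ideal.Quotient.mk_surjective x
    have hPx : ∀ r, r ∈ P ↔ x * r ∈ monomialIdeal l 1 0 := fun r => by rw [hx, hmem]
    classical
    let T : Finset (ι × ι) := Finset.univ.filter
      fun p => p.1 ≠ p.2 ∧ x ∉ Ideal.span {l p.1, l p.2}
    -- `P` is the annihilator of `x` modulo the ideal. It contains the finite intersection of those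
    -- primes `(l i, l j)` that miss `x`, hence contains one of them, and then equals it.
    have hT : T.inf (fun p => Ideal.span {l p.1, l p.2}) ≤ P := by
      intro r hr
      rw [hPx, hl.mem_monomialIdeal_iff]
      intro i j hij
      rw [pow_one]
      by_cases hxi : x ∈ Ideal.span {l i, l j}
      · exact Ideal.mul_mem_right _ _ hxi
      · have : (i, j) ∈ T := by simp [T, hij, hxi]
        exact Ideal.mul_mem_left _ _ (Finset.inf_le (f := fun p : ι × ι =>
          Ideal.span {l p.1, l p.2}) this hr)
    obtain ⟨⟨i, j⟩, hmemT, hle⟩ := (hP.inf_le').1 hT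
    simp only [T, Finset.mem_filter, Finset.mem_univ, true_and] at hmemT
    refine ⟨i, j, hmemT.1, le_antisymm (fun r hr => ?_) hle⟩
    have := (hl.mem_monomialIdeal_iff 1).1 ((hPx r).1 hr) i j hmemT.1
    rw [pow_one] at this
    exact ((hl.isPrime hmemT.1).mem_or_mem this).resolve_left hmemT.2
  · rintro ⟨i, j, hij, rfl⟩
    obtain ⟨v, -, hv⟩ := hl.exists_colon hij
    exact ⟨hl.isPrime hij, Ideal.Quotient.mk _ v, by ext r; rw [hmem, hv]⟩

theorem symbolicPower_eq [IsNoetherianRing R] (m : ℕ) :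
    symbolicPower (monomialIdeal l 1 0) m = monomialIdeal l m 0 := by
  ext F
  simp only [symbolicPower, Ideal.mem_iInf, Ideal.mem_comap, hl.mem_associatedPrimes_iff]
  rw [hl.mem_monomialIdeal_iff]
  have hloc : ∀ i j, i ≠ j → ∀ _ : (Ideal.span {l i, l j}).IsPrime,
      (algebraMap R (Localization.AtPrime (Ideal.span {l i, l j})) F ∈
        (monomialIdeal l 1 0 ^ m).map
          (algebraMap R (Localization.AtPrime (Ideal.span {l i, l j}))) ↔
      F ∈ Ideal.span {l i, l j} ^ m) := by
    intro i j hij _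
    rw [IsLocalization.algebraMap_mem_map_algebraMap_iff (Ideal.span {l i, l j}).primeCompl]
    constructor
    · rintro ⟨u, hu, huF⟩
      have hle := monomialIdeal_le_pow l 1 hij
      rw [pow_one] at hle
      exact hl.mem_pow_of_mul_mem hij hu (Ideal.pow_right_mono hle m huF)
    · intro hF
      obtain ⟨v, hvm, hv⟩ := hl.exists_colon hij
      -- Outside the prime, `v` carries it into the ideal of the configuration, so `v ^ m` carries
      -- its `m`-th power into the `m`-th power of that ideal.
      refine ⟨v ^ m, pow_mem (S := (Ideal.span {l i, l j}).primeCompl) hvm m, ?_⟩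
      have hle : Ideal.span {v} * Ideal.span {l i, l j} ≤ monomialIdeal l 1 0 := by
        rw [Ideal.span_singleton_mul_le_iff]
        exact fun F hF => (hv F).2 hF
      refine Ideal.pow_right_mono hle m ?_
      rw [mul_pow]
      exact Ideal.mul_mem_mul (Ideal.pow_mem_pow (Ideal.mem_span_singleton_self _) _) hF
  constructor
  · intro h i j hij
    have := hl.isPrime hij
    exact (hloc i j hij this).1 (h _ this ⟨i, j, hij, rfl⟩)
  · rintro h P hP ⟨i, j, hij, rfl⟩
    exact (hloc i j hij hP).2 (h i j hij)

end IsStarFamily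

end Symbolic

/-! ### Formal consequences of the two relations between the symbolic powers. -/

section Containment

variable {R : Type*} [CommRing R] {S : ℕ → Ideal R}

theorem eq_pow_of_add_two (h : ∀ n, S (n + 2) = S 2 * S n) (j r : ℕ) :
    S (2 * j + r) = S 2 ^ j * S r := by
  induction j with
  | zero => simp
  | succ j ih => rw [show 2 * (j + 1) + r = 2 * j + r + 2 by ring, h, ih, pow_succ']; ring

theorem le_pow_of_succ_le {M : Ideal R} (hM : ∀ n, S (n + 1) ≤ M * S n) (n : ℕ) :
    S n ≤ M ^ n := by
  induction n with
  | zero => simp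
  | succ n ih => rw [pow_succ']; exact (hM n).trans (Ideal.mul_mono_right ih)

/-- For `m = 2 * q`, `S m = S 2 ^ q`; splitting off `S m ^ t` leaves `S t` or `S (t - 1)`, which
lies in the matching power of `M`. For odd `m`, `S (t * (m + 1)) = S (m + 1) ^ t` and `S (t * (m +
1) - 1) = S (m + 1) ^ (t - 1) * S m`, with `S (m + 1) ≤ M * S m`. -/
theorem containment (h0 : S 0 = ⊤) (h : ∀ n, S (n + 2) = S 2 * S n) {M : Ideal R}
    (hM : ∀ n, S (n + 1) ≤ M * S n) (m t : ℕ) (ht : 1 ≤ t) :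
    S (t * (m + 1)) ≤ M ^ t * S m ^ t ∧ S (t * (m + 1) - 1) ≤ M ^ (t - 1) * S m ^ t := by
  have hS := eq_pow_of_add_two h
  have hS0 : ∀ j, S (2 * j) = S 2 ^ j := fun j => by
    have := hS j 0
    rwa [h0, Ideal.mul_top, add_zero] at this
  obtain ⟨t, rfl⟩ := Nat.exists_eq_add_of_le' ht
  rw [Nat.add_sub_cancel]
  obtain ⟨q, rfl | rfl⟩ := Nat.even_or_odd' m
  · have hq : ∀ r, S (2 * (q * (t + 1)) + r) ≤ M ^ r * S (2 * q) ^ (t + 1) := fun r => by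
      rw [hS, hS0, ← pow_mul, mul_comm (M ^ r)]
      exact Ideal.mul_mono_right (le_pow_of_succ_le hM r)
    constructor
    · convert hq (t + 1) using 2
      ring
    · convert hq t using 2
      rw [Nat.sub_eq_iff_eq_add (by nlinarith)]
      ring
  · have he : S (2 * (q + 1)) ≤ M * S (2 * q + 1) := hM (2 * q + 1)
    constructor
    · rw [show (t + 1) * (2 * q + 1 + 1) = 2 * ((q + 1) * (t + 1)) by ring, hS0, pow_mul,
        ← hS0, ← mul_pow]
      exact Ideal.pow_right_mono he _
    · rw [show (t + 1) * (2 * q + 1 + 1) - 1 = 2 * ((q + 1) * t + q) + 1 by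
        rw [Nat.sub_eq_iff_eq_add (by nlinarith)]; ring, hS, pow_add, mul_assoc, ← hS, pow_mul,
        ← hS0, pow_succ (S (2 * q + 1)), ← mul_assoc, ← mul_pow]
      exact Ideal.mul_mono_left (Ideal.pow_right_mono he _)

end Containment

/-! ### Linear forms, points and lines of the projective plane. -/

section Plane

open MvPolynomial Matrix

variable {K : Type*} [Field K]

/-- The linear form with coefficient vector `v`. -/
noncomputable def linearForm (v : Fin 3 → K) : MvPolynomial (Fin 3) K :=
  ∑ i, C (v i) * X i

theorem eval_linearForm (v q : Fin 3 → K) : eval q (linearForm v) = v ⬝ᵥ q := by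
  simp [linearForm, dotProduct]

theorem isHomogeneous_linearForm (v : Fin 3 → K) : (linearForm v).IsHomogeneous 1 :=
  IsHomogeneous.sum _ _ _ fun i _ => by
    simpa using (isHomogeneous_C (Fin 3) (v i)).mul (isHomogeneous_X K i)

theorem linearForm_mem_irrelevantIdeal (v : Fin 3 → K) : linearForm v ∈ irrelevantIdeal K :=
  Ideal.sum_mem _ fun i _ => Ideal.mul_mem_left _ _ (Ideal.subset_span ⟨i, rfl⟩)

theorem linearForm_vecMul (v : Fin 3 → K) (A : Matrix (Fin 3) (Fin 3) K) :
    linearForm (v ᵥ* A) = ∑ i, C (v i) * linearForm (A i) := by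
  simp only [linearForm, vecMul, dotProduct, map_sum, map_mul, Finset.sum_mul, Finset.mul_sum,
    mul_assoc]
  exact Finset.sum_comm

theorem linearForm_single (i : Fin 3) : linearForm (Pi.single i (1 : K)) = X i := by
  simp [linearForm, Pi.single_apply]

theorem aeval_linearForm (A : Matrix (Fin 3) (Fin 3) K) (v : Fin 3 → K) :
    aeval (fun i => linearForm (A i)) (linearForm v) = linearForm (v ᵥ* A) := by
  rw [linearForm_vecMul, linearForm]
  simp [algebraMap_eq]

theorem isFrame_of_det_ne_zero {u v w : Fin 3 → K} (h : Matrix.det ![u, v, w] ≠ 0) :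
    IsFrame (linearForm u) (linearForm v) (linearForm w) := by
  set A : Matrix (Fin 3) (Fin 3) K := ![u, v, w] with hA
  have key : ∀ B D : Matrix (Fin 3) (Fin 3) K, B * D = 1 →
      (aeval (fun i => linearForm (D i))).comp (aeval (fun i => linearForm (B i))) =
        AlgHom.id K (MvPolynomial (Fin 3) K) := by
    intro B D hBD
    ext i : 1
    rw [AlgHom.comp_apply, aeval_X, aeval_linearForm, AlgHom.id_apply, ← linearForm_single]
    congr 1
    have := congrFun hBD i
    rw [mul_apply_eq_vecMul] at this
    rw [this]
    ext j
    simp [one_apply, Pi.single_apply, eq_comm]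
  have hu : IsUnit A.det := isUnit_iff_ne_zero.2 h
  refine ⟨AlgEquiv.ofAlgHom _ _ (key _ _ (nonsing_inv_mul A hu)) (key _ _ (mul_nonsing_inv A hu)),
    ?_, ?_, ?_⟩ <;> simp [hA]

theorem aeval_mul_of_isHomogeneous {B : Type*} [CommRing B] [Algebra K B]
    {F : MvPolynomial (Fin 3) K} {d : ℕ} (hF : F.IsHomogeneous d) (q : Fin 3 → K) (T : B) :
    aeval (fun i => algebraMap K B (q i) * T) F = algebraMap K B (eval q F) * T ^ d := by
  rw [aeval_def, eval₂_eq', eval_eq', map_sum, Finset.sum_mul]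
  refine Finset.sum_congr rfl fun m hm => ?_
  have hdeg : ∑ i, m i = d := by
    rw [← hF (mem_support_iff.1 hm)]
    simp [Finsupp.weight_apply, Finsupp.sum_fintype]
  simp only [mul_pow, Finset.prod_mul_distrib, Finset.prod_pow_eq_pow_sum, hdeg, map_mul, map_prod,
    map_pow, mul_assoc]

/-- Linear forms vanishing at `q` are combinations of those of `u` and `v`. Modulo these two, each
`X i` is therefore `q i` times one common element `T`, and homogeneity gives `F ≡ F(q) T ^ d = 0`.
-/
theorem mem_span_of_eval_eq_zero {u v w q : Fin 3 → K} (h : Matrix.det ![u, v, w] ≠ 0)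
    (hq : q ≠ 0) (hu : u ⬝ᵥ q = 0) (hv : v ⬝ᵥ q = 0) {F : MvPolynomial (Fin 3) K} {d : ℕ}
    (hF : F.IsHomogeneous d) (hFq : eval q F = 0) :
    F ∈ Ideal.span {linearForm u, linearForm v} := by
  set A : Matrix (Fin 3) (Fin 3) K := ![u, v, w] with hA
  have hw : w ⬝ᵥ q ≠ 0 := by
    intro hw
    refine h (exists_mulVec_eq_zero_iff.1 ⟨q, hq, ?_⟩)
    ext i
    fin_cases i
    · exact hu
    · exact hv
    · exact hw
  have hr : ∀ r : Fin 3 → K, r ⬝ᵥ q = 0 →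
      linearForm r ∈ Ideal.span {linearForm u, linearForm v} := by
    intro r hr
    have hb : (r ᵥ* A⁻¹) ᵥ* A = r := by
      rw [vecMul_vecMul, nonsing_inv_mul A (isUnit_iff_ne_zero.2 h), vecMul_one]
    set b := r ᵥ* A⁻¹
    have hAq : A *ᵥ q = ![0, 0, w ⬝ᵥ q] := by
      ext i
      fin_cases i
      · exact hu
      · exact hv
      · rfl
    have hb2 : b 2 = 0 := by
      rw [← hb, ← dotProduct_mulVec, hAq] at hr
      rw [dotProduct, Fin.sum_univ_three] at hr
      simpa [hw] using hr
    rw [← hb, linearForm_vecMul, Fin.sum_univ_three, hb2]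
    simp only [map_zero, zero_mul, add_zero]
    exact add_mem (Ideal.mul_mem_left _ _ (Ideal.subset_span (by simp [hA])))
      (Ideal.mul_mem_left _ _ (Ideal.subset_span (by simp [hA])))
  set P := Ideal.span {linearForm u, linearForm v}
  have hX : ∀ i, Ideal.Quotient.mkₐ K P (X i) = algebraMap K _ (q i) *
      Ideal.Quotient.mkₐ K P (C (w ⬝ᵥ q)⁻¹ * linearForm w) := by
    intro i
    have h1 : (Pi.single i 1 - (q i * (w ⬝ᵥ q)⁻¹) • w) ⬝ᵥ q = 0 := by
      simp [sub_dotProduct, hw]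
    have h2 : linearForm (Pi.single i 1 - (q i * (w ⬝ᵥ q)⁻¹) • w) =
        X i - C (q i) * (C (w ⬝ᵥ q)⁻¹ * linearForm w) := by
      rw [← linearForm_single]
      simp only [linearForm, Pi.sub_apply, Pi.smul_apply, smul_eq_mul, map_sub, map_mul, sub_mul,
        Finset.sum_sub_distrib, Finset.mul_sum, mul_assoc]
    have h3 := hr _ h1
    rw [h2, ← Ideal.Quotient.eq_zero_iff_mem, map_sub, sub_eq_zero, map_mul] at h3
    exact h3
  have hπ : Ideal.Quotient.mkₐ K P F = aeval (fun i => Ideal.Quotient.mkₐ K P (X i)) F := by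
    rw [← comp_aeval_apply, aeval_X_left, AlgHom.id_apply]
  simp only [hX] at hπ
  rw [aeval_mul_of_isHomogeneous hF, hFq, map_zero, zero_mul] at hπ
  exact Ideal.Quotient.eq_zero_iff_mem.1 hπ

theorem mem_line_iff (a p : ℙ K (Fin 3 → K)) : p ∈ line a ↔ a.rep ⬝ᵥ p.rep = 0 := by
  rw [← Projectivization.orthogonal_mk a.rep_nonzero p.rep_nonzero, Projectivization.mk_rep,
    Projectivization.mk_rep]
  rfl

theorem exists_det_ne_zero {a b : ℙ K (Fin 3 → K)} (h : a ≠ b) :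
    ∃ w, Matrix.det ![a.rep, b.rep, w] ≠ 0 := by
  have hc : a.rep ⨯₃ b.rep ≠ 0 := by
    rw [Ne, ← Projectivization.mk_eq_mk_iff_crossProduct_eq_zero a.rep_nonzero b.rep_nonzero,
      Projectivization.mk_rep, Projectivization.mk_rep]
    exact h
  obtain ⟨k, hk⟩ := Function.ne_iff.1 hc
  -- With a basis vector as last row, the determinant is the `k`-th coordinate of the cross product.
  refine ⟨Pi.single k 1, ?_⟩
  rw [← triple_product_eq_det, triple_product_permutation, triple_product_permutation]
  simpa using hk

namespace IsStarArrangement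

variable {s : ℕ} {a : Fin s → ℙ K (Fin 3 → K)} (ha : IsStarArrangement a)
include ha

theorem det_ne_zero {i j k : Fin s} (hij : i ≠ j) (hik : i ≠ k) (hjk : j ≠ k) :
    Matrix.det ![(a i).rep, (a j).rep, (a k).rep] ≠ 0 := by
  intro h
  obtain ⟨q, hq, hA⟩ := exists_mulVec_eq_zero_iff.2 h
  have hmem : ∀ b : ℙ K (Fin 3 → K), b.rep ⬝ᵥ q = 0 → Projectivization.mk K q hq ∈ line b := by
    intro b hb
    rw [line, Set.mem_ofPred_eq, ← b.mk_rep, Projectivization.orthogonal_mk b.rep_nonzero hq]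
    exact hb
  have := ha.no_three i j k hij hik hjk
  exact this.le ⟨⟨hmem _ (congrFun hA 0), hmem _ (congrFun hA 1)⟩, hmem _ (congrFun hA 2)⟩

theorem isStarFamily : IsStarFamily fun i => linearForm (a i).rep := by
  have hframe : ∀ {i j : Fin s}, i ≠ j →
      ∃ w, IsFrame (linearForm (a i).rep) (linearForm (a j).rep) (linearForm w) := fun hij =>
    (exists_det_ne_zero (ha.injective.ne hij)).imp fun _ h => isFrame_of_det_ne_zero h
  refine ⟨fun hij hik hjk => (isFrame_of_det_ne_zero (ha.det_ne_zero hij hik hjk)).notMem,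
    fun hij => ?_, fun hij => ?_, fun hij => ?_, fun hij => ?_⟩ <;>
  obtain ⟨w, hw⟩ := hframe hij
  · exact hw.isPrime
  · exact hw.mem_pow_of_mul_mem
  · exact hw.mem_pow_of_left_mul_mem
  · exact hw.mem_span_pow_of_mul_mem

/-- A form through all the points lies in each `(l i, l j)`. Conversely, at `L_i ∩ L_j` a generating
product vanishes because `b i + b j ≥ 1`. -/
theorem pointsIdeal_eq :
    pointsIdeal (starPoints a) = monomialIdeal (fun i => linearForm (a i).rep) 1 0 := by
  classical
  apply le_antisymm
  · rw [pointsIdeal, Ideal.span_le]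
    rintro F ⟨⟨d, hF⟩, hFp⟩
    rw [SetLike.mem_coe, ha.isStarFamily.mem_monomialIdeal_iff]
    intro i j hij
    have hne := ha.injective.ne hij
    obtain ⟨w, hw⟩ := exists_det_ne_zero hne
    have hi := Projectivization.orthogonal_cross_left hne
    have hj := Projectivization.orthogonal_cross_right hne
    set p := Projectivization.cross (a i) (a j)
    rw [pow_one]
    exact mem_span_of_eval_eq_zero hw p.rep_nonzero ((mem_line_iff _ _).1 hi)
      ((mem_line_iff _ _).1 hj) hF (hFp p ⟨i, j, hij, hi, hj⟩)
  · rw [monomialIdeal, Ideal.span_le]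
    rintro _ ⟨b, hb, rfl⟩
    refine Ideal.subset_span ⟨⟨_, IsHomogeneous.prod _ _ _ fun i _ =>
      (isHomogeneous_linearForm (a i).rep).pow (b i)⟩, ?_⟩
    rintro p ⟨i, j, hij, hi, hj⟩
    have hzero : ∀ k, p ∈ line (a k) → 1 ≤ b k →
        eval p.rep (∏ k, linearForm (a k).rep ^ b k) = 0 := by
      intro k hk hbk
      rw [map_prod]
      refine Finset.prod_eq_zero (Finset.mem_univ k) ?_
      rw [map_pow, eval_linearForm, (mem_line_iff _ _).1 hk, zero_pow (by omega)]
    have := hb i j hij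
    simp only [Pi.zero_apply] at this
    by_cases h : 1 ≤ b i
    · exact hzero i hi h
    · exact hzero j hj (by omega)

end IsStarArrangement

end Plane

end StarConfig

theorem mainTheorem7 {K : Type*} [Field K] [IsAlgClosed K] {s : ℕ}
    (a : Fin s → ℙ K (Fin 3 → K)) (ha : StarConfig.IsStarArrangement a)
    (I M : Ideal (MvPolynomial (Fin 3) K))
    (hI : I = StarConfig.pointsIdeal (StarConfig.starPoints a))
    (hM : M = StarConfig.irrelevantIdeal K) :
    (∀ j : ℕ, StarConfig.symbolicPower I (2 * j + 1) = StarConfig.symbolicPower I 2 ^ j * I) ∧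
    (CharZero K → ∀ m t : ℕ, 1 ≤ m → 1 ≤ t →
      StarConfig.symbolicPower I (t * (m + 1)) ≤ M ^ t * StarConfig.symbolicPower I m ^ t ∧
      StarConfig.symbolicPower I (t * (m + 1) - 1) ≤ StarConfig.symbolicPower I m ^ t ∧
      StarConfig.symbolicPower I (t * (m + 1) - 1) ≤
        M ^ (t - 1) * StarConfig.symbolicPower I m ^ t) := by
  subst hI hM
  have : Nontrivial (Fin s) := Fin.nontrivial_iff_two_le.2 ha.two_le
  rw [ha.pointsIdeal_eq]
  set l := fun i => StarConfig.linearForm (a i).rep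
  have hl : StarConfig.IsStarFamily l := ha.isStarFamily
  simp only [hl.symbolicPower_eq]
  have h0 := StarConfig.monomialIdeal_zero l
  have h2 := StarConfig.monomialIdeal_add_two l
  have hM := StarConfig.monomialIdeal_succ_le l
    fun i => StarConfig.linearForm_mem_irrelevantIdeal (a i).rep
  refine ⟨fun j => StarConfig.eq_pow_of_add_two
    (S := fun n => StarConfig.monomialIdeal l n 0) h2 j 1, fun _ m t _ ht => ?_⟩
  obtain ⟨h1, h3⟩ :=
    StarConfig.containment (S := fun n => StarConfig.monomialIdeal l n 0) h0 h2 hM m t ht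
  exact ⟨h1, h3.trans Ideal.mul_le_right, h3⟩
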